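/- Work over $\mathbb{C}$, and let $\mathrm{Gr}(2,\mathbb{C}^4)$ denote the Grassmannian of two-dimensional quotient spaces of $\mathbb{C}^4$. Let $a,b$ be coprime positive integers. A surjection of vector bundles $$\phi:\ \mathbb{C}^4\otimes\mathcal{O}_{\mathbb{P}^2}\longrightarrow \mathcal{O}_{\mathbb{P}^2}(a)\oplus\mathcal{O}_{\mathbb{P}^2}(b)$$ induces the morphism $f_\phi:\mathbb{P}^2\to \mathrm{Gr}(2,\mathbb{C}^4)$ that sends a point $x$ to the quotient $\mathbb{C}^4\to \mathcal{O}_{\mathbb{P}^2}(a)_x\oplus\mathcal{O}_{\mathbb{P}^2}(b)_x$ of $\mathbb{C}^4$ given by $\phi$ on the fibres at $x$. Then for a generic $\phi$ the morphism $f_\phi$ is birational onto its image. That is, the finite-dimensional vector space $$\mathrm{Hom}\bigl(\mathbb{C}^4,\,H^0(\mathbb{P}^2,\mathcal{O}_{\mathbb{P}^2}(a)\oplus\mathcal{O}_{\mathbb{P}^2}(b))\bigr)$$ contains a nonempty Zariski open subset $U$ such that every $\phi\in U$ is a surjection of vector bundles and $f_\phi$ restricts to an isomorphism from a nonempty Zariski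 open subset of $\mathbb{P}^2$ onto a Zariski open subset of the image $f_\phi(\mathbb{P}^2)$. -/

import Mathlib

open MvPolynomial
open scoped LinearAlgebra.Projectivization

noncomputable section

namespace PlaneGr

/-! ### Zariski topology on a complex vector space -/

/-- The polynomial functions on a finite-dimensional complex vector space `W` are the polynomials
in its linear forms. A subset of `W` is Zariski open if its complement is the common zero set of a
set of polynomial functions. -/
def IsZariskiOpenLinear {W : Type*} [AddCommGroup W] [Module ℂ W] (U : Set W) : Prop :=
  ∃ S : Set (MvPolynomial (Module.Dual ℂ W) ℂ),
    Uᶜ = {w | ∀ P ∈ S, eval (fun l : Module.Dual ℂ W => l w) P = 0}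

/-! ### Embedded projective varieties, regular maps, birational morphisms -/

/-- A realisation of a classical complex variety `X`, given by its set of points, inside the
projective space with homogeneous coordinates indexed by `σ`. The Zariski topology and the regular
maps of `X` are those induced by this embedding. -/
class ProjEmbedded (X : Type*) (σ : outParam Type*) where
  toProj : X → ℙ ℂ (σ → ℂ)
  toProj_injective : Function.Injective toProj

/-- Homogeneous coordinates of a point (a chosen representative; everything below only evaluates
homogeneous polynomials at it, in a way that does not depend on the choice). -/
def coords {X σ : Type*} [ProjEmbedded X σ] (x : X) : σ → ℂ :=
  (ProjEmbedded.toProj x).rep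

/-- Zariski closed subsets: common zero sets of homogeneous polynomials in the coordinates. -/
def IsZariskiClosed {X σ : Type*} [ProjEmbedded X σ] (Z : Set X) : Prop :=
  ∃ S : Set (MvPolynomial σ ℂ), (∀ F ∈ S, ∃ d : ℕ, F.IsHomogeneous d) ∧
    Z = {x | ∀ F ∈ S, eval (coords x) F = 0}

/-- Zariski open subsets. -/
def IsZariskiOpen {X σ : Type*} [ProjEmbedded X σ] (U : Set X) : Prop :=
  IsZariskiClosed Uᶜ

/-- `g` is a regular map on the (locally closed) subset `V` of `X`: locally on `V`, in the Zariski
topology, it is given by homogeneous polynomials of one degree without common zero. Values of `g`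
outside `V` are irrelevant. -/
def IsRegularOn {X Y σ τ : Type*} [ProjEmbedded X σ] [ProjEmbedded Y τ]
    (g : X → Y) (V : Set X) : Prop :=
  ∀ x ∈ V, ∃ O : Set X, IsZariskiOpen O ∧ x ∈ O ∧
    ∃ (d : ℕ) (G : τ → MvPolynomial σ ℂ), (∀ i, (G i).IsHomogeneous d) ∧
      ∀ y ∈ V ∩ O, ∃ h : (fun i => eval (coords y) (G i)) ≠ 0,
        ProjEmbedded.toProj (g y) = Projectivization.mk ℂ (fun i => eval (coords y) (G i)) h

/-- `f : X → Y`, with `X` irreducible and projective (so that the image `f(X)` is an irreducible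
closed subvariety of `Y`), is a morphism that is birational onto its image: `f` is regular and it
restricts to an isomorphism from a nonempty Zariski open subset `U` of `X` onto a relatively
Zariski open subset `f(U) = O ∩ f(X)` of the image, that is, the inverse `g : f(U) → U` is
regular. -/
def IsBirationalOntoImage {X Y σ τ : Type*} [ProjEmbedded X σ] [ProjEmbedded Y τ]
    (f : X → Y) : Prop :=
  IsRegularOn f Set.univ ∧
    ∃ (U : Set X) (O : Set Y) (g : Y → X),
      IsZariskiOpen U ∧ U.Nonempty ∧ IsZariskiOpen O ∧ f '' U = O ∩ Set.range f ∧
      (∀ x ∈ U, g (f x) = x) ∧ IsRegularOn g (f '' U)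

/-! ### The projective plane and the Grassmannian of two-dimensional quotients -/

/-- The complex projective plane. -/
abbrev P2 : Type := ℙ ℂ (Fin 3 → ℂ)

instance : ProjEmbedded P2 (Fin 3) where
  toProj := id
  toProj_injective := Function.injective_id

/-- The Grassmannian of two-dimensional quotients `ℂ⁴ ⧸ K` of `ℂ⁴`; a point is the kernel `K`. -/
abbrev Gr24 : Type := Module.Grassmannian ℂ (Fin 4 → ℂ) 2

/-- The six pairs `i < j` of indices in `{0,1,2,3}`. -/
abbrev Pairs : Type := {p : Fin 4 × Fin 4 // p.1 < p.2}

theorem Gr24.finrank_quotient (K : Gr24) :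
    Module.finrank ℂ ((Fin 4 → ℂ) ⧸ K.toSubmodule) = 2 := by
  have h := K.rankAtStalk_eq ⊥
  rwa [Module.rankAtStalk_eq_finrank_of_free] at h

/-- A basis of the quotient `ℂ⁴ ⧸ K`. -/
def quotBasis (K : Gr24) : Module.Basis (Fin 2) ℂ ((Fin 4 → ℂ) ⧸ K.toSubmodule) :=
  Module.finBasisOfFinrankEq _ _ K.finrank_quotient

/-- The determinant of the images of `v` and `w` in `ℂ⁴ ⧸ K`, with respect to a chosen basis. -/
def quotDet (K : Gr24) : (Fin 4 → ℂ) [⋀^Fin 2]→ₗ[ℂ] ℂ :=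
  (quotBasis K).det.compLinearMap K.toSubmodule.mkQ

/-- The Plücker coordinates of `ℂ⁴ → ℂ⁴ ⧸ K`: the `2 × 2` minors of its matrix. A change of the
basis of `ℂ⁴ ⧸ K` multiplies all of them by the same nonzero number. -/
def pluckerCoords (K : Gr24) : Pairs → ℂ :=
  fun p => quotDet K ![Pi.single p.1.1 1, Pi.single p.1.2 1]

theorem alt_ext {f g : (Fin 4 → ℂ) [⋀^Fin 2]→ₗ[ℂ] ℂ}
    (h : ∀ p : Pairs, f ![Pi.single p.1.1 1, Pi.single p.1.2 1] =
      g ![Pi.single p.1.1 1, Pi.single p.1.2 1]) : f = g := by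
  have key : ∀ i j : Fin 4, i < j → f ![Pi.single i 1, Pi.single j 1] =
      g ![Pi.single i 1, Pi.single j 1] := fun i j hij => h ⟨(i, j), hij⟩
  have sw : ∀ (k : (Fin 4 → ℂ) [⋀^Fin 2]→ₗ[ℂ] ℂ) (x y : Fin 4 → ℂ), k ![x, y] = -k ![y, x] := by
    intro k x y
    have := k.map_swap ![y, x] (i := 0) (j := 1) (by decide)
    rw [← this]
    congr 1
    ext i
    fin_cases i <;> simp
  refine Module.Basis.ext_alternating (Pi.basisFun ℂ (Fin 4)) fun v hv => ?_
  have e : (fun i => Pi.basisFun ℂ (Fin 4) (v i)) =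
      ![Pi.single (v 0) (1 : ℂ), Pi.single (v 1) 1] := by
    ext i
    fin_cases i <;> simp
  rw [e]
  have hne : v 0 ≠ v 1 := fun h => absurd (hv h) (by decide)
  rcases lt_or_gt_of_ne hne with h1 | h1
  · exact key _ _ h1
  · rw [sw f, sw g, key _ _ h1]

theorem mem_iff_quotDet (K : Gr24) (v : Fin 4 → ℂ) :
    v ∈ K.toSubmodule ↔ ∀ w, quotDet K ![v, w] = 0 := by
  have hd : ∀ w, quotDet K ![v, w] =
      (quotBasis K).repr (K.toSubmodule.mkQ v) 0 * (quotBasis K).repr (K.toSubmodule.mkQ w) 1 -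
      (quotBasis K).repr (K.toSubmodule.mkQ w) 0 * (quotBasis K).repr (K.toSubmodule.mkQ v) 1 := by
    intro w
    simp [quotDet, Module.Basis.det_apply, Matrix.det_fin_two, Module.Basis.toMatrix_apply]
  constructor
  · intro h w
    have h0 : K.toSubmodule.mkQ v = 0 := by simpa using h
    rw [hd, h0]
    simp
  · intro h
    obtain ⟨w0, hw0⟩ := K.toSubmodule.mkQ_surjective (quotBasis K 0)
    obtain ⟨w1, hw1⟩ := K.toSubmodule.mkQ_surjective (quotBasis K 1)
    have a0 := h w0
    have a1 := h w1
    rw [hd, hw0] at a0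
    rw [hd, hw1] at a1
    have h0 : K.toSubmodule.mkQ v = 0 := by
      apply (quotBasis K).repr.injective
      ext i
      fin_cases i
      · simpa using a1
      · simpa using a0
    simpa using h0

theorem pluckerCoords_ne_zero (K : Gr24) : pluckerCoords K ≠ 0 := by
  intro h
  have h0 : quotDet K = 0 := alt_ext fun p => by simpa [pluckerCoords] using congrFun h p
  have hall : K.toSubmodule = ⊤ := by
    ext v
    simp [mem_iff_quotDet, h0]
  have h2 := K.finrank_quotient
  have : Subsingleton ((Fin 4 → ℂ) ⧸ K.toSubmodule) := by
    rw [hall]; infer_instance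
  rw [Module.finrank_zero_of_subsingleton] at h2
  omega

/-- The Plücker embedding of the Grassmannian in five-dimensional projective space. -/
def plucker (K : Gr24) : ℙ ℂ (Pairs → ℂ) :=
  Projectivization.mk ℂ (pluckerCoords K) (pluckerCoords_ne_zero K)

theorem plucker_injective : Function.Injective plucker := by
  intro K K' h
  obtain ⟨c, hc⟩ := (Projectivization.mk_eq_mk_iff ℂ _ _ _ _).1 h
  have hq : (c : ℂ) • quotDet K' = quotDet K := alt_ext fun p => by
    simpa [pluckerCoords, Units.smul_def] using congrFun hc p
  apply Module.Grassmannian.ext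
  ext v
  rw [mem_iff_quotDet, mem_iff_quotDet, ← hq]
  simp

instance : ProjEmbedded Gr24 Pairs where
  toProj := plucker
  toProj_injective := plucker_injective

/-! ### Line bundles on the plane and maps from the trivial bundle of rank four -/

/-- Global sections of `𝒪(d)` on the plane: ternary forms of degree `d`. -/
abbrev Forms (d : ℕ) : Type := homogeneousSubmodule (Fin 3) ℂ d

/-- The fibre at `x` of the line bundle `𝒪(d)`, the `d`-th power of the dual of the tautological
line bundle: the functions on the line `x ⊆ ℂ³` that are homogeneous of degree `d`. -/
def twistFiber (d : ℕ) (x : P2) : Submodule ℂ (x.submodule → ℂ) where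
  carrier := {h | ∀ (t : ℂ) (v : x.submodule), h (t • v) = t ^ d * h v}
  add_mem' := by
    intro f g hf hg t v
    simp [hf t v, hg t v, mul_add]
  zero_mem' := by simp
  smul_mem' := by
    intro c f hf t v
    simp [hf t v, mul_left_comm]

theorem eval_smul_of_homogeneous {d : ℕ} {F : MvPolynomial (Fin 3) ℂ} (hF : F.IsHomogeneous d)
    (t : ℂ) (v : Fin 3 → ℂ) : eval (t • v) F = t ^ d * eval v F := by
  rw [eval_eq, eval_eq, Finset.mul_sum]
  refine Finset.sum_congr rfl fun m hm => ?_
  have hdeg : ∑ i ∈ m.support, m i = d := by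
    have h := hF (mem_support_iff.1 hm)
    rw [← h, Finsupp.weight_apply]
    simp [Finsupp.sum]
  simp only [Pi.smul_apply, smul_eq_mul, mul_pow, Finset.prod_mul_distrib]
  rw [Finset.prod_pow_eq_pow_sum, hdeg]
  ring

/-- The value at `x` of a global section of `𝒪(d)`: the restriction of the form to the line `x`. -/
def evalSection (d : ℕ) (x : P2) : Forms d →ₗ[ℂ] twistFiber d x where
  toFun s := ⟨fun v => eval (v : Fin 3 → ℂ) (s : MvPolynomial (Fin 3) ℂ), fun t v => by
    exact eval_smul_of_homogeneous ((mem_homogeneousSubmodule d _).1 s.2) t (v : Fin 3 → ℂ)⟩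
  map_add' := by
    intro s t
    ext v
    simp
  map_smul' := by
    intro c s
    ext v
    simp [smul_eval]

/-- Morphisms of vector bundles `ℂ⁴ ⊗ 𝒪 → 𝒪(a) ⊕ 𝒪(b)` on the plane, that is, linear maps from
`ℂ⁴` to the global sections of `𝒪(a) ⊕ 𝒪(b)`. -/
abbrev BundleMap (a b : ℕ) : Type := (Fin 4 → ℂ) →ₗ[ℂ] Forms a × Forms b

/-- The linear map induced by `φ` on the fibres at `x`. -/
def fiberMap {a b : ℕ} (φ : BundleMap a b) (x : P2) :
    (Fin 4 → ℂ) →ₗ[ℂ] twistFiber a x × twistFiber b x :=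
  ((evalSection a x).prodMap (evalSection b x)) ∘ₗ φ

/-- `φ` is a surjection of vector bundles. -/
def IsSurjection {a b : ℕ} (φ : BundleMap a b) : Prop :=
  ∀ x : P2, Function.Surjective (fiberMap φ x)

/-- Trivialisation of the fibre of `𝒪(d)` at `x` by the value at a chosen nonzero vector. -/
def twistFiberEquiv (d : ℕ) (x : P2) : twistFiber d x ≃ₗ[ℂ] ℂ := by
  have hx : x.rep ∈ x.submodule := by
    rw [Projectivization.submodule_eq]; exact Submodule.mem_span_singleton_self _
  have hgen : ∀ v : x.submodule, ∃ t : ℂ, v = t • (⟨x.rep, hx⟩ : x.submodule) := by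
    intro v
    obtain ⟨t, ht⟩ := Submodule.mem_span_singleton.1
      ((Projectivization.submodule_eq x).le v.2)
    exact ⟨t, Subtype.ext ht.symm⟩
  refine LinearEquiv.ofBijective
    ((LinearMap.proj (⟨x.rep, hx⟩ : x.submodule)).comp (twistFiber d x).subtype) ⟨?_, ?_⟩
  · intro f g hfg
    ext v
    obtain ⟨t, rfl⟩ := hgen v
    rw [f.2 t, g.2 t]
    exact congrArg _ hfg
  · intro c
    obtain ⟨i, hi⟩ := Function.ne_iff.1 x.rep_nonzero
    have hi' : x.rep i ≠ 0 := hi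
    refine ⟨⟨fun v => ((v : Fin 3 → ℂ) i / x.rep i) ^ d * c, fun t v => ?_⟩, ?_⟩
    · simp only [Submodule.coe_smul, Pi.smul_apply, smul_eq_mul]
      rw [mul_div_assoc, mul_pow, mul_assoc]
    · simp [hi']

/-- The morphism to the Grassmannian given by a surjection `φ`: it sends `x` to the quotient
`ℂ⁴ → 𝒪(a)ₓ ⊕ 𝒪(b)ₓ` of `ℂ⁴`, recorded by its kernel. -/
def inducedMap {a b : ℕ} (φ : BundleMap a b) (hφ : IsSurjection φ) (x : P2) : Gr24 where
  toSubmodule := (fiberMap φ x).ker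
  finite_quotient := inferInstance
  projective_quotient := inferInstance
  rankAtStalk_eq := by
    intro p
    have e := ((fiberMap φ x).quotKerEquivOfSurjective (hφ x)).trans
      ((twistFiberEquiv a x).prodCongr (twistFiberEquiv b x))
    rw [Module.rankAtStalk_eq_finrank_of_free]
    simp [e.finrank_eq]

end PlaneGr

end

open PlaneGr

noncomputable section

namespace PlaneGr

/-! A point x is recovered from the plane spanned by the two rows A(x), B(x) of φ. If y is the
Plücker vector of that plane, x is a common zero of the forms r ∧ y with r = A, B, whose
coefficients are linear in y (`incidence`). Fix multipliers (`Combination`) that turn these forms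
and the power x₀^N into one form of degree N for each monomial of degree N. Where the determinant
`discr` of their coefficients does not vanish at y, they are a basis of the forms of degree N.
Evaluation at x kills everything but the x₀^N part, so Cramer's rule gives F(x) / x₀^N as a quotient
of polynomials in y (`pow_mul_eval_cramerPoly`). The choices F = x₀^(N-1) xᵢ yield a regular inverse
on the locus `discr` ≠ 0 (`isBirationalOntoImage`).

With the multipliers fixed, `discr` at the minors of φ at (1, 0, 0) is polynomial in φ, so its
nonvanishing is an open condition. Surjectivity is likewise implied by the nonvanishing of a
polynomial in φ (`exists_polyFun_isSurjection`). It remains to exhibit one φ₀ where both polynomials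
are nonzero. The rows `specialRowA` and `specialRowB` do this: their minors have no common zero
(`eq_zero_of_minors_special`), and at (1, 0, 0) the incidence forms are the entries of the last two
columns, which together with x₀^N span the forms of degree N = 2a + b
(`exists_combination_special`). -/

/-! ### Polynomial functions on a vector space -/

/-- The algebra of polynomial functions on a complex vector space. -/
def polyFun (W : Type*) [AddCommGroup W] [Module ℂ W] : Subalgebra ℂ (W → ℂ) :=
  (aeval fun (l : Module.Dual ℂ W) (w : W) => l w : MvPolynomial (Module.Dual ℂ W) ℂ →ₐ[ℂ] W → ℂ).range

section PolyFun

variable {W : Type*} [AddCommGroup W] [Module ℂ W]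

theorem linear_mem_polyFun (l : W →ₗ[ℂ] ℂ) : (fun w => l w) ∈ polyFun W :=
  ⟨X l, by simp⟩

theorem const_mem_polyFun (c : ℂ) : (fun _ => c) ∈ polyFun W :=
  (polyFun W).algebraMap_mem c

theorem isZariskiOpenLinear_ne_zero {D : W → ℂ} (hD : D ∈ polyFun W) :
    IsZariskiOpenLinear {w | D w ≠ 0} := by
  obtain ⟨P, rfl⟩ := hD
  refine ⟨{P}, ?_⟩
  ext w
  have : (aeval fun (l : Module.Dual ℂ W) (w : W) => l w : _ →ₐ[ℂ] W → ℂ) P w =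
      eval (fun l : Module.Dual ℂ W => l w) P := by
    induction P using MvPolynomial.induction_on with
    | C c => simp
    | add p q hp hq => simp [hp, hq]
    | mul_X p l hp => simp [hp]
  simp [this]

theorem det_mem_polyFun {n : Type*} [Fintype n] [DecidableEq n] {A : W → Matrix n n ℂ}
    (hA : ∀ i j, (fun w => A w i j) ∈ polyFun W) : (fun w => (A w).det) ∈ polyFun W := by
  have : (fun w => (A w).det) =
      ∑ σ : Equiv.Perm n, (Equiv.Perm.sign σ : ℤ) • ∏ i, fun w => A w (σ i) i := by
    ext w
    simp [Matrix.det_apply, Units.smul_def, Finset.sum_apply, Finset.prod_apply]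
  rw [this]
  exact sum_mem fun σ _ => zsmul_mem (prod_mem fun i _ => hA _ _) _

end PolyFun

/-! ### Homogeneous polynomials -/

section Homogeneous

variable {σ : Type*}

theorem eval_smul_of_isHomogeneous {F : MvPolynomial σ ℂ} {d : ℕ} (hF : F.IsHomogeneous d)
    (t : ℂ) (v : σ → ℂ) : eval (t • v) F = t ^ d * eval v F := by
  rw [eval_eq, eval_eq, Finset.mul_sum]
  refine Finset.sum_congr rfl fun m hm => ?_
  have hdeg : ∑ i ∈ m.support, m i = d := by
    have h := hF (mem_support_iff.1 hm)
    rw [← h, Finsupp.weight_apply]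
    simp [Finsupp.sum]
  simp only [Pi.smul_apply, smul_eq_mul, mul_pow, Finset.prod_mul_distrib]
  rw [Finset.prod_pow_eq_pow_sum, hdeg]
  ring

theorem isHomogeneous_det {n : Type*} [Fintype n] [DecidableEq n]
    {A : Matrix n n (MvPolynomial σ ℂ)} (hA : ∀ i j, (A i j).IsHomogeneous 1) :
    A.det.IsHomogeneous (Fintype.card n) := by
  rw [Matrix.det_apply]
  refine IsHomogeneous.sum _ _ _ fun τ _ => ?_
  have h : (∏ i, A (τ i) i).IsHomogeneous (Fintype.card n) := by
    simpa using IsHomogeneous.prod Finset.univ (fun i => A (τ i) i) (fun _ => 1) fun i _ => hA _ _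
  rcases Int.units_eq_one_or (Equiv.Perm.sign τ) with h1 | h1
  · simpa [h1] using h
  · simpa [h1] using h.neg

/-- Allows the coefficients of an ideal membership between forms to be replaced by their components
of a single degree. -/
theorem homogeneousComponent_mul_of_isHomogeneous {G : MvPolynomial σ ℂ} {d : ℕ}
    (hG : G.IsHomogeneous d) (F : MvPolynomial σ ℂ) (n : ℕ) :
    homogeneousComponent n F * G = homogeneousComponent (n + d) (F * G) := by
  conv_rhs => rw [← sum_homogeneousComponent F, Finset.sum_mul, map_sum]
  have h : ∀ i, homogeneousComponent (n + d) (homogeneousComponent i F * G) =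
      if i = n then homogeneousComponent n F * G else 0 := by
    intro i
    rw [homogeneousComponent_of_mem ((homogeneousComponent_isHomogeneous i F).mul hG)]
    by_cases hi : i = n
    · simp [hi]
    · rw [if_neg hi, if_neg (by omega)]
  simp only [h, Finset.sum_ite_eq', Finset.mem_range]
  split_ifs with hn
  · rfl
  · rw [homogeneousComponent_eq_zero _ _ (by omega), zero_mul]

variable [Fintype σ] [DecidableEq σ]

/-- A linear form as a polynomial. -/
def linPoly (l : (σ → ℂ) →ₗ[ℂ] ℂ) : MvPolynomial σ ℂ :=
  ∑ p, C (l (Pi.single p 1)) * X p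

theorem isHomogeneous_linPoly (l : (σ → ℂ) →ₗ[ℂ] ℂ) : (linPoly l).IsHomogeneous 1 :=
  IsHomogeneous.sum _ _ _ fun p _ => isHomogeneous_C_mul_X _ p

theorem eval_linPoly (l : (σ → ℂ) →ₗ[ℂ] ℂ) (y : σ → ℂ) : eval y (linPoly l) = l y := by
  conv_rhs => rw [pi_eq_sum_univ' y]
  simp [linPoly, mul_comm]

end Homogeneous

/-! ### Families of ternary forms indexed by the monomials of their degree -/

/-- The exponents of the ternary monomials of degree `N`. -/
abbrev Mono (N : ℕ) : Type := ↥(Finset.finsuppAntidiag (Finset.univ : Finset (Fin 3)) N)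

theorem mem_mono {N : ℕ} {m : Fin 3 →₀ ℕ} :
    m ∈ Finset.finsuppAntidiag (Finset.univ : Finset (Fin 3)) N ↔ m 0 + m 1 + m 2 = N := by
  simp [Finset.mem_finsuppAntidiag, Fin.sum_univ_three]

theorem degree_fin_three (m : Fin 3 →₀ ℕ) : m.degree = m 0 + m 1 + m 2 := by
  simp [Finsupp.degree_eq_sum, Fin.sum_univ_three]

/-- The matrix of coefficients of a family of forms. -/
def coeffMatrix {N : ℕ} (P : Mono N → MvPolynomial (Fin 3) ℂ) : Matrix (Mono N) (Mono N) ℂ :=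
  Matrix.of fun i j => coeff i (P j)

theorem coeffMatrix_monomial (N : ℕ) :
    coeffMatrix (fun j : Mono N => monomial (j : Fin 3 →₀ ℕ) 1) = 1 := by
  ext i j
  simp only [coeffMatrix, Matrix.of_apply, coeff_monomial, Matrix.one_apply, Subtype.ext_iff]
  exact if_congr eq_comm rfl rfl

theorem sum_smul_eq_of_mulVec {N : ℕ} {P : Mono N → MvPolynomial (Fin 3) ℂ}
    (hP : ∀ j, (P j).IsHomogeneous N) {F : MvPolynomial (Fin 3) ℂ} (hF : F.IsHomogeneous N)
    {u : Mono N → ℂ} (hu : (coeffMatrix P).mulVec u = fun i : Mono N => coeff (i : Fin 3 →₀ ℕ) F) :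
    ∑ j, u j • P j = F := by
  ext m
  by_cases hm : m 0 + m 1 + m 2 = N
  · have := congrFun hu ⟨m, mem_mono.2 hm⟩
    simpa [Matrix.mulVec, dotProduct, coeffMatrix, coeff_sum, mul_comm] using this
  · have hm' : m.degree ≠ N := by rwa [degree_fin_three]
    rw [hF.coeff_eq_zero hm', coeff_sum]
    exact Finset.sum_eq_zero fun j _ => by simp [(hP j).coeff_eq_zero hm']

theorem exists_sum_smul_eq {N : ℕ} {P : Mono N → MvPolynomial (Fin 3) ℂ}
    (hP : ∀ j, (P j).IsHomogeneous N) (hdet : (coeffMatrix P).det ≠ 0)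
    {F : MvPolynomial (Fin 3) ℂ} (hF : F.IsHomogeneous N) :
    ∃ u : Mono N → ℂ, ∑ j, u j • P j = F := by
  refine ⟨(coeffMatrix P)⁻¹.mulVec fun i : Mono N => coeff (i : Fin 3 →₀ ℕ) F, sum_smul_eq_of_mulVec hP hF ?_⟩
  rw [Matrix.mulVec_mulVec, Matrix.mul_nonsing_inv _ (isUnit_iff_ne_zero.2 hdet), Matrix.one_mulVec]

/-- Cramer's rule without division: the coefficients stay polynomial in the entries of the matrix,
hence later in the Plücker coordinates. -/
theorem sum_cramer_smul {N : ℕ} {P : Mono N → MvPolynomial (Fin 3) ℂ}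
    (hP : ∀ j, (P j).IsHomogeneous N) {F : MvPolynomial (Fin 3) ℂ} (hF : F.IsHomogeneous N) :
    ∑ j, (coeffMatrix P).cramer (fun i : Mono N => coeff (i : Fin 3 →₀ ℕ) F) j • P j = (coeffMatrix P).det • F := by
  refine sum_smul_eq_of_mulVec hP (by rw [smul_eq_C_mul]; exact hF.C_mul _) ?_
  rw [Matrix.mulVec_cramer]
  ext i
  simp

/-- Forms of positive degree without a common zero generate all the monomials of some degree. -/
theorem exists_monomial_eq_sum {ι : Type*} [Fintype ι] {d : ℕ} {m : ι → MvPolynomial (Fin 3) ℂ}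
    (hm : ∀ p, (m p).IsHomogeneous d)
    (hz : ∀ v : Fin 3 → ℂ, (∀ p, eval v (m p) = 0) → v = 0) :
    ∃ (N : ℕ) (h : Mono (N + d) → ι → MvPolynomial (Fin 3) ℂ),
      (∀ j p, (h j p).IsHomogeneous N) ∧ ∀ j, ∑ p, h j p * m p = monomial (j : Fin 3 →₀ ℕ) 1 := by
  set I : Ideal (MvPolynomial (Fin 3) ℂ) := Ideal.span (Set.range m) with hI
  have hX : ∀ i, X i ∈ I.radical := by
    intro i
    -- Nullstellensatz: the zero locus is at most the origin, where every variable vanishes.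
    rw [← vanishingIdeal_zeroLocus_eq_radical (K := ℂ) I]
    rw [mem_vanishingIdeal_iff]
    intro v hv
    have : v = 0 := hz v fun p => by
      have := (mem_zeroLocus_iff.1 hv) (m p) (Ideal.subset_span ⟨p, rfl⟩)
      simpa [aeval_eq_eval] using this
    simp [this]
  choose k hk using fun i => hX i
  -- Some power `X i ^ k i` lies in `I`; a monomial of degree at least k₀ + k₁ + k₂ is divisible by
  -- one of these three powers.
  refine ⟨k 0 + k 1 + k 2, ?_⟩
  have key : ∀ j : Mono (k 0 + k 1 + k 2 + d), ∃ h : ι → MvPolynomial (Fin 3) ℂ,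
      (∀ p, (h p).IsHomogeneous (k 0 + k 1 + k 2)) ∧
        ∑ p, h p * m p = monomial (j : Fin 3 →₀ ℕ) 1 := by
    intro j
    have hj := mem_mono.1 j.2
    have hmem : monomial (j : Fin 3 →₀ ℕ) (1 : ℂ) ∈ I := by
      obtain ⟨i, hi⟩ : ∃ i, k i ≤ (j : Fin 3 →₀ ℕ) i := by
        by_contra! hc
        have := hc 0
        have := hc 1
        have := hc 2
        omega
      rw [monomial_eq, Finsupp.prod_fintype _ _ (by simp), ← Finset.mul_prod_erase _ _ (Finset.mem_univ i)]
      refine I.mul_mem_left _ (I.mul_mem_right _ ?_)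
      exact Ideal.mem_of_dvd _ (pow_dvd_pow _ hi) (hk i)
    obtain ⟨c, hc⟩ := (Submodule.mem_span_range_iff_exists_fun _).1 hmem
    refine ⟨fun p => homogeneousComponent (k 0 + k 1 + k 2) (c p),
      fun p => homogeneousComponent_isHomogeneous _ _, ?_⟩
    have hc' := congrArg (homogeneousComponent (k 0 + k 1 + k 2 + d)) hc
    rw [map_sum] at hc'
    have hmon : (monomial (j : Fin 3 →₀ ℕ) (1 : ℂ)).IsHomogeneous (k 0 + k 1 + k 2 + d) :=
      isHomogeneous_monomial _ (by rw [degree_fin_three, hj])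
    rw [homogeneousComponent_of_mem hmon, if_pos rfl] at hc'
    rw [← hc']
    refine Finset.sum_congr rfl fun p _ => ?_
    exact homogeneousComponent_mul_of_isHomogeneous (hm p) _ _
  choose h h1 h2 using key
  exact ⟨h, h1, h2⟩

/-! ### The matrix of forms of a bundle map and its minors -/

section Rows

variable {a b : ℕ}

/-- The first row of the matrix of `φ`: the forms of degree `a`. -/
def rowA (φ : BundleMap a b) (i : Fin 4) : MvPolynomial (Fin 3) ℂ := (φ (Pi.single i 1)).1

/-- The second row of the matrix of `φ`: the forms of degree `b`. -/
def rowB (φ : BundleMap a b) (i : Fin 4) : MvPolynomial (Fin 3) ℂ := (φ (Pi.single i 1)).2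

/-- The `2 × 2` minors of the matrix of `φ`. -/
def minors (φ : BundleMap a b) (p : Pairs) : MvPolynomial (Fin 3) ℂ :=
  rowA φ p.1.1 * rowB φ p.1.2 - rowA φ p.1.2 * rowB φ p.1.1

/-- The values of the minors at a vector. -/
def minorsAt (φ : BundleMap a b) (v : Fin 3 → ℂ) (p : Pairs) : ℂ := eval v (minors φ p)

theorem isHomogeneous_rowA (φ : BundleMap a b) (i : Fin 4) : (rowA φ i).IsHomogeneous a :=
  (mem_homogeneousSubmodule a _).1 (φ (Pi.single i 1)).1.2

theorem isHomogeneous_rowB (φ : BundleMap a b) (i : Fin 4) : (rowB φ i).IsHomogeneous b :=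
  (mem_homogeneousSubmodule b _).1 (φ (Pi.single i 1)).2.2

theorem isHomogeneous_minors (φ : BundleMap a b) (p : Pairs) :
    (minors φ p).IsHomogeneous (a + b) :=
  ((isHomogeneous_rowA φ _).mul (isHomogeneous_rowB φ _)).sub
    ((isHomogeneous_rowA φ _).mul (isHomogeneous_rowB φ _))

/-- The bundle map with given rows. -/
def ofRows (s : Fin 4 → Forms a) (t : Fin 4 → Forms b) : BundleMap a b :=
  (Pi.basisFun ℂ (Fin 4)).constr ℂ fun i => (s i, t i)

theorem rowA_ofRows (s : Fin 4 → Forms a) (t : Fin 4 → Forms b) (i : Fin 4) :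
    rowA (ofRows s t) i = s i := by
  have := (Pi.basisFun ℂ (Fin 4)).constr_basis ℂ (fun i => (s i, t i)) i
  rw [Pi.basisFun_apply] at this
  rw [rowA, ofRows, this]

theorem rowB_ofRows (s : Fin 4 → Forms a) (t : Fin 4 → Forms b) (i : Fin 4) :
    rowB (ofRows s t) i = t i := by
  have := (Pi.basisFun ℂ (Fin 4)).constr_basis ℂ (fun i => (s i, t i)) i
  rw [Pi.basisFun_apply] at this
  rw [rowB, ofRows, this]

theorem coeff_mul_rowA_mem_polyFun (m : Fin 3 →₀ ℕ) (h : MvPolynomial (Fin 3) ℂ) (i : Fin 4) :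
    (fun φ : BundleMap a b => coeff m (h * rowA φ i)) ∈ polyFun (BundleMap a b) :=
  linear_mem_polyFun
    { toFun := fun φ => coeff m (h * rowA φ i)
      map_add' := fun φ ψ => by simp [rowA, mul_add]
      map_smul' := fun c φ => by simp [rowA] }

theorem coeff_mul_rowB_mem_polyFun (m : Fin 3 →₀ ℕ) (h : MvPolynomial (Fin 3) ℂ) (i : Fin 4) :
    (fun φ : BundleMap a b => coeff m (h * rowB φ i)) ∈ polyFun (BundleMap a b) :=
  linear_mem_polyFun
    { toFun := fun φ => coeff m (h * rowB φ i)
      map_add' := fun φ ψ => by simp [rowB, mul_add]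
      map_smul' := fun c φ => by simp [rowB] }

/-- Each minor is bilinear in the two rows, so its coefficients are sums of products of linear
functions of φ. -/
theorem coeff_mul_minors_mem_polyFun (m : Fin 3 →₀ ℕ) (h : MvPolynomial (Fin 3) ℂ) (p : Pairs) :
    (fun φ : BundleMap a b => coeff m (h * minors φ p)) ∈ polyFun (BundleMap a b) := by
  have key : ∀ i j : Fin 4, (fun φ : BundleMap a b => coeff m (h * (rowA φ i * rowB φ j))) ∈
      polyFun (BundleMap a b) := by
    intro i j
    have : (fun φ : BundleMap a b => coeff m (h * (rowA φ i * rowB φ j))) =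
        ∑ x ∈ Finset.HasAntidiagonal.antidiagonal m, (fun φ => coeff x.1 (h * rowA φ i)) *
          fun φ => coeff x.2 (1 * rowB φ j) := by
      ext φ
      simp [← mul_assoc, coeff_mul, Finset.sum_apply]
    rw [this]
    exact sum_mem fun x _ => mul_mem (coeff_mul_rowA_mem_polyFun _ _ _)
      (coeff_mul_rowB_mem_polyFun _ _ _)
  have := sub_mem (key p.1.1 p.1.2) (key p.1.2 p.1.1)
  convert this using 1
  ext φ
  simp [minors, mul_sub]

theorem minorsAt_mem_polyFun (v : Fin 3 → ℂ) (p : Pairs) :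
    (fun φ : BundleMap a b => minorsAt φ v p) ∈ polyFun (BundleMap a b) := by
  have hA : ∀ i, (fun φ : BundleMap a b => eval v (rowA φ i)) ∈ polyFun (BundleMap a b) := fun i =>
    linear_mem_polyFun
      { toFun := fun φ => eval v (rowA φ i)
        map_add' := fun φ ψ => by simp [rowA]
        map_smul' := fun c φ => by simp [rowA, smul_eval] }
  have hB : ∀ i, (fun φ : BundleMap a b => eval v (rowB φ i)) ∈ polyFun (BundleMap a b) := fun i =>
    linear_mem_polyFun
      { toFun := fun φ => eval v (rowB φ i)
        map_add' := fun φ ψ => by simp [rowB]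
        map_smul' := fun c φ => by simp [rowB, smul_eval] }
  have := sub_mem (mul_mem (hA p.1.1) (hB p.1.2)) (mul_mem (hA p.1.2) (hB p.1.1))
  convert this using 1
  ext φ
  simp [minorsAt, minors]

/-! ### Fibres and Plücker coordinates -/

/-- The map on fibres in the trivialisations at `x.rep`. -/
def fiberPair (φ : BundleMap a b) (x : P2) : (Fin 4 → ℂ) →ₗ[ℂ] ℂ × ℂ :=
  ((twistFiberEquiv a x).prodCongr (twistFiberEquiv b x)).toLinearMap ∘ₗ fiberMap φ x

theorem fiberPair_single (φ : BundleMap a b) (x : P2) (i : Fin 4) :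
    fiberPair φ x (Pi.single i 1) = (eval x.rep (rowA φ i), eval x.rep (rowB φ i)) := rfl

/-- The alternating form whose coordinates are the minors at `x.rep`. -/
def minorForm (φ : BundleMap a b) (x : P2) : (Fin 4 → ℂ) [⋀^Fin 2]→ₗ[ℂ] ℂ :=
  (Module.Basis.finTwoProd ℂ).det.compLinearMap (fiberPair φ x)

theorem minorForm_apply (φ : BundleMap a b) (x : P2) (v w : Fin 4 → ℂ) :
    minorForm φ x ![v, w] =
      (fiberPair φ x v).1 * (fiberPair φ x w).2 - (fiberPair φ x w).1 * (fiberPair φ x v).2 := by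
  simp [minorForm, Module.Basis.det_apply, Matrix.det_fin_two, Module.Basis.toMatrix_apply]

theorem minorForm_single (φ : BundleMap a b) (x : P2) (p : Pairs) :
    minorForm φ x ![Pi.single p.1.1 1, Pi.single p.1.2 1] = minorsAt φ x.rep p := by
  simp [minorForm_apply, fiberPair_single, minorsAt, minors]

theorem isSurjection_of_minors {φ : BundleMap a b}
    (h : ∀ v : Fin 3 → ℂ, (∀ p, eval v (minors φ p) = 0) → v = 0) : IsSurjection φ := by
  intro x
  obtain ⟨p, hp⟩ : ∃ p, minorsAt φ x.rep p ≠ 0 := by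
    by_contra! hc
    exact x.rep_nonzero (h _ hc)
  have hs : Function.Surjective (fiberPair φ x) := by
    rintro ⟨c, d⟩
    rw [← minorForm_single, minorForm_apply] at hp
    set u := fiberPair φ x (Pi.single p.1.1 1)
    set w := fiberPair φ x (Pi.single p.1.2 1)
    set D := u.1 * w.2 - w.1 * u.2
    -- Cramer's rule for the two columns `u`, `w`, whose determinant `D` is the nonzero minor.
    refine ⟨((c * w.2 - w.1 * d) / D) • Pi.single p.1.1 1 + ((u.1 * d - c * u.2) / D) • Pi.single p.1.2 1, ?_⟩
    rw [map_add, map_smul, map_smul]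
    ext
    · simp only [Prod.fst_add, Prod.smul_fst, smul_eq_mul]
      change _ / D * u.1 + _ / D * w.1 = _
      field_simp
      ring
    · simp only [Prod.snd_add, Prod.smul_snd, smul_eq_mul]
      change _ / D * u.2 + _ / D * w.2 = _
      field_simp
      ring
  intro z
  obtain ⟨v, hv⟩ := hs (((twistFiberEquiv a x).prodCongr (twistFiberEquiv b x)) z)
  exact ⟨v, ((twistFiberEquiv a x).prodCongr (twistFiberEquiv b x)).injective hv⟩

/-- The chosen basis of the quotient and the one given by the trivialised fibres differ by a change
of basis, whose determinant is the scalar `c`. -/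
theorem exists_pluckerCoords_inducedMap (φ : BundleMap a b) (hφ : IsSurjection φ) (x : P2) :
    ∃ c : ℂ, c ≠ 0 ∧ pluckerCoords (inducedMap φ hφ x) = c • minorsAt φ x.rep := by
  set K := inducedMap φ hφ x with hK
  let e : ((Fin 4 → ℂ) ⧸ K.toSubmodule) ≃ₗ[ℂ] ℂ × ℂ :=
    ((fiberMap φ x).quotKerEquivOfSurjective (hφ x)).trans
      ((twistFiberEquiv a x).prodCongr (twistFiberEquiv b x))
  have he : ∀ v, e (K.toSubmodule.mkQ v) = fiberPair φ x v := fun v => rfl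
  let B := (Module.Basis.finTwoProd ℂ).map e.symm
  have h := (quotBasis K).det.eq_smul_basis_det B
  set c := (quotBasis K).det B
  have hp : pluckerCoords K = c • minorsAt φ x.rep := by
    ext p
    rw [pluckerCoords, quotDet, h, Pi.smul_apply, ← minorForm_single, minorForm]
    simp only [AlternatingMap.compLinearMap_apply, AlternatingMap.smul_apply, B,
      Module.Basis.det_map, LinearEquiv.symm_symm]
    rfl
  refine ⟨c, fun hc => pluckerCoords_ne_zero K ?_, hp⟩
  rw [hp, hc, zero_smul]

theorem minorsAt_rep_ne_zero {φ : BundleMap a b} (hφ : IsSurjection φ) (x : P2) :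
    minorsAt φ x.rep ≠ 0 := by
  obtain ⟨c, -, hc⟩ := exists_pluckerCoords_inducedMap φ hφ x
  intro h
  exact pluckerCoords_ne_zero _ (by rw [hc, h, smul_zero])

theorem toProj_inducedMap {φ : BundleMap a b} (hφ : IsSurjection φ) (x : P2) :
    ProjEmbedded.toProj (inducedMap φ hφ x) =
      Projectivization.mk ℂ (minorsAt φ x.rep) (minorsAt_rep_ne_zero hφ x) := by
  obtain ⟨c, hc0, hc⟩ := exists_pluckerCoords_inducedMap φ hφ x
  exact (Projectivization.mk_eq_mk_iff ℂ _ _ _ _).2 ⟨Units.mk0 c hc0, hc.symm⟩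

/-- The chosen representative in projective space is known only up to scale; hence the factor `c` in
the statements about evaluation at Plücker coordinates. -/
theorem exists_coords_inducedMap {φ : BundleMap a b} (hφ : IsSurjection φ) (x : P2) :
    ∃ c : ℂ, c ≠ 0 ∧ coords (inducedMap φ hφ x) = c • minorsAt φ x.rep := by
  have h := toProj_inducedMap hφ x
  rw [← Projectivization.mk_rep (ProjEmbedded.toProj (inducedMap φ hφ x)),
    Projectivization.mk_eq_mk_iff] at h
  obtain ⟨c, hc⟩ := h
  exact ⟨c, c.ne_zero, hc.symm⟩

theorem isRegularOn_inducedMap {φ : BundleMap a b} (hφ : IsSurjection φ) :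
    IsRegularOn (inducedMap φ hφ) Set.univ := by
  intro x _
  refine ⟨Set.univ, ⟨{1}, by simpa using ⟨0, isHomogeneous_one _ _⟩, by simp⟩, trivial, a + b,
    minors φ, isHomogeneous_minors φ, fun y _ => ⟨minorsAt_rep_ne_zero hφ y, toProj_inducedMap hφ y⟩⟩

/-! ### Surjectivity is a Zariski open condition -/

/-- The multipliers that express the monomials through the minors of `φ₀` are kept while φ varies.
The determinant of the resulting forms is 1 at `φ₀`; where it is nonzero, the minors of φ still
generate a power of each variable, so they have no common zero. -/
theorem exists_polyFun_isSurjection {φ₀ : BundleMap a b}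
    (h₀ : ∀ v : Fin 3 → ℂ, (∀ p, eval v (minors φ₀ p) = 0) → v = 0) :
    ∃ D ∈ polyFun (BundleMap a b), D φ₀ ≠ 0 ∧ ∀ φ, D φ ≠ 0 → IsSurjection φ := by
  obtain ⟨N, h, hh, hsum⟩ := exists_monomial_eq_sum (isHomogeneous_minors φ₀) h₀
  let P : BundleMap a b → Mono (N + (a + b)) → MvPolynomial (Fin 3) ℂ :=
    fun φ j => ∑ p, h j p * minors φ p
  have hP : ∀ φ j, (P φ j).IsHomogeneous (N + (a + b)) := fun φ j =>
    IsHomogeneous.sum _ _ _ fun p _ => (hh j p).mul (isHomogeneous_minors φ p)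
  refine ⟨fun φ => (coeffMatrix (P φ)).det, det_mem_polyFun fun i j => ?_, ?_, fun φ hφ => ?_⟩
  · have : (fun φ => coeffMatrix (P φ) i j) =
        ∑ p, fun φ => coeff (i : Fin 3 →₀ ℕ) (h j p * minors φ p) := by
      ext φ
      simp [coeffMatrix, P, coeff_sum, Finset.sum_apply]
    rw [this]
    exact sum_mem fun p _ => coeff_mul_minors_mem_polyFun _ _ _
  · have : P φ₀ = fun j : Mono (N + (a + b)) => monomial (j : Fin 3 →₀ ℕ) 1 := funext hsum
    simp [this, coeffMatrix_monomial]
  · refine isSurjection_of_minors fun v hv => ?_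
    ext i
    obtain ⟨u, hu⟩ := exists_sum_smul_eq (hP φ) hφ (isHomogeneous_X_pow i (N + (a + b)))
    have := congrArg (eval v) hu
    simp only [map_sum, smul_eval, P, map_mul, hv, mul_zero, Finset.sum_const_zero, map_pow,
      eval_X] at this
    exact IsReduced.eq_zero _ ⟨_, this.symm⟩

end Rows

/-! ### Recovering a point of the plane from its Plücker coordinates -/

section Inverse

variable {a b N : ℕ}

/-- The first pair of indices. -/
def firstPair : Pairs := ⟨(0, 1), by decide⟩

/-- A row `r` lies in the plane with Plücker coordinates `y` only if these forms vanish: they are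
the coordinates of `r ∧ y` at the triples `0, 1, k`. -/
def incidence (r : Fin 4 → MvPolynomial (Fin 3) ℂ) (k : {k : Fin 4 // 1 < k}) :
    (Pairs → ℂ) →ₗ[ℂ] MvPolynomial (Fin 3) ℂ :=
  (LinearMap.proj ⟨(1, k.1), k.2⟩ : (Pairs → ℂ) →ₗ[ℂ] ℂ).smulRight (r 0) -
    (LinearMap.proj ⟨(0, k.1), lt_trans (show (0 : Fin 4) < 1 by decide) k.2⟩ : (Pairs → ℂ) →ₗ[ℂ] ℂ).smulRight (r 1) +
    (LinearMap.proj firstPair : (Pairs → ℂ) →ₗ[ℂ] ℂ).smulRight (r k)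

/-- When the plane is spanned by the first two basis vectors, incidence means that the remaining
entries of the row vanish. -/
theorem incidence_single (r : Fin 4 → MvPolynomial (Fin 3) ℂ) (k : {k : Fin 4 // 1 < k}) :
    incidence r k (Pi.single firstPair 1) = r k := by
  obtain ⟨k, hk⟩ := k
  have h1 : (⟨(1, k), hk⟩ : Pairs) ≠ firstPair := by simp [firstPair]
  have h2 : (⟨(0, k), lt_trans (show (0 : Fin 4) < 1 by decide) hk⟩ : Pairs) ≠ firstPair := by
    simp only [firstPair, ne_eq, Subtype.mk.injEq, Prod.mk.injEq, true_and]
    exact hk.ne'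
  simp only [incidence, LinearMap.add_apply, LinearMap.sub_apply, LinearMap.smulRight_apply,
    LinearMap.proj_apply, Pi.single_eq_same]
  rw [Pi.single_eq_of_ne h1, Pi.single_eq_of_ne h2]
  simp

theorem isHomogeneous_incidence {r : Fin 4 → MvPolynomial (Fin 3) ℂ} {d : ℕ}
    (hr : ∀ i, (r i).IsHomogeneous d) (k : {k : Fin 4 // 1 < k}) (y : Pairs → ℂ) :
    (incidence r k y).IsHomogeneous d := by
  simp only [incidence, LinearMap.add_apply, LinearMap.sub_apply, LinearMap.smulRight_apply,
    smul_eq_C_mul]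
  exact (((hr _).C_mul _).sub ((hr _).C_mul _)).add ((hr _).C_mul _)

/-- This is the expansion of a 3 × 3 determinant in the columns 0, 1, k with a repeated row. -/
theorem eval_incidence_rowA (φ : BundleMap a b) (k : {k : Fin 4 // 1 < k}) (v : Fin 3 → ℂ) :
    eval v (incidence (rowA φ) k (minorsAt φ v)) = 0 := by
  simp [incidence, minorsAt, minors, firstPair, smul_eval]
  ring

theorem eval_incidence_rowB (φ : BundleMap a b) (k : {k : Fin 4 // 1 < k}) (v : Fin 3 → ℂ) :
    eval v (incidence (rowB φ) k (minorsAt φ v)) = 0 := by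
  simp [incidence, minorsAt, minors, firstPair, smul_eval]
  ring

/-- Coefficients of a family of combinations of degree `N` of the incidence equations and of a
power of the first variable. -/
structure Combination (a b N : ℕ) where
  degA : ℕ
  degB : ℕ
  coefA : Mono N → {k : Fin 4 // 1 < k} → MvPolynomial (Fin 3) ℂ
  coefB : Mono N → {k : Fin 4 // 1 < k} → MvPolynomial (Fin 3) ℂ
  coefX : Mono N → ℂ
  degA_add : degA + a = N
  degB_add : degB + b = N
  homA : ∀ j k, (coefA j k).IsHomogeneous degA
  homB : ∀ j k, (coefB j k).IsHomogeneous degB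

namespace Combination

variable (H : Combination a b N)

/-- The family of forms with the given coefficients, linear in the Plücker coordinates. -/
def family (φ : BundleMap a b) (j : Mono N) : (Pairs → ℂ) →ₗ[ℂ] MvPolynomial (Fin 3) ℂ :=
  ∑ k, (LinearMap.mulLeft ℂ (H.coefA j k) ∘ₗ incidence (rowA φ) k +
    LinearMap.mulLeft ℂ (H.coefB j k) ∘ₗ incidence (rowB φ) k) +
    (LinearMap.proj firstPair : (Pairs → ℂ) →ₗ[ℂ] ℂ).smulRight (C (H.coefX j) * X 0 ^ N)

theorem family_apply (φ : BundleMap a b) (j : Mono N) (y : Pairs → ℂ) :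
    H.family φ j y = ∑ k, (H.coefA j k * incidence (rowA φ) k y +
      H.coefB j k * incidence (rowB φ) k y) + y firstPair • (C (H.coefX j) * X 0 ^ N) := by
  simp [family, LinearMap.sum_apply]

theorem isHomogeneous_family (φ : BundleMap a b) (j : Mono N) (y : Pairs → ℂ) :
    (H.family φ j y).IsHomogeneous N := by
  rw [family_apply]
  refine (IsHomogeneous.sum _ _ _ fun k _ => ?_).add ?_
  · have hA := (H.homA j k).mul (isHomogeneous_incidence (isHomogeneous_rowA φ) k y)
    have hB := (H.homB j k).mul (isHomogeneous_incidence (isHomogeneous_rowB φ) k y)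
    rw [H.degA_add] at hA
    rw [H.degB_add] at hB
    exact hA.add hB
  · rw [smul_eq_C_mul]
    exact ((isHomogeneous_X_pow 0 N).C_mul _).C_mul _

theorem eval_family (φ : BundleMap a b) (j : Mono N) (c : ℂ) (v : Fin 3 → ℂ) :
    eval v (H.family φ j (c • minorsAt φ v)) =
      (c • minorsAt φ v) firstPair * v 0 ^ N * H.coefX j := by
  rw [family_apply]
  simp [smul_eval, eval_incidence_rowA, eval_incidence_rowB]
  ring

/-- The coefficient matrix of the family at the Plücker coordinates `y`. -/
def matrixAt (φ : BundleMap a b) (y : Pairs → ℂ) : Matrix (Mono N) (Mono N) ℂ :=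
  coeffMatrix fun j => H.family φ j y

/-- The coefficient matrix of the family, with the Plücker coordinates as variables. -/
def polyMatrix (φ : BundleMap a b) : Matrix (Mono N) (Mono N) (MvPolynomial Pairs ℂ) :=
  Matrix.of fun i j => linPoly (lcoeff ℂ (i : Fin 3 →₀ ℕ) ∘ₗ H.family φ j)

theorem map_polyMatrix (φ : BundleMap a b) (y : Pairs → ℂ) :
    (H.polyMatrix φ).map (eval y) = H.matrixAt φ y := by
  ext i j
  simp [polyMatrix, matrixAt, coeffMatrix, eval_linPoly]

/-- The polynomial in the Plücker coordinates whose nonvanishing makes the family a basis. -/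
def discr (φ : BundleMap a b) : MvPolynomial Pairs ℂ := (H.polyMatrix φ).det

theorem isHomogeneous_discr (φ : BundleMap a b) :
    (H.discr φ).IsHomogeneous (Fintype.card (Mono N)) :=
  isHomogeneous_det fun _ _ => isHomogeneous_linPoly _

theorem eval_discr (φ : BundleMap a b) (y : Pairs → ℂ) :
    eval y (H.discr φ) = (H.matrixAt φ y).det := by
  rw [discr, RingHom.map_det, RingHom.mapMatrix_apply, map_polyMatrix]

/-- The coefficient of the power of the first variable in the expression of `F` by the family,
by Cramer's rule. -/
def cramerPoly (φ : BundleMap a b) (F : MvPolynomial (Fin 3) ℂ) : MvPolynomial Pairs ℂ :=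
  ∑ j, C (H.coefX j) * ((H.polyMatrix φ).updateCol j fun i =>
    linPoly (coeff (i : Fin 3 →₀ ℕ) F • LinearMap.proj firstPair)).det

theorem isHomogeneous_cramerPoly (φ : BundleMap a b) (F : MvPolynomial (Fin 3) ℂ) :
    (H.cramerPoly φ F).IsHomogeneous (Fintype.card (Mono N)) := by
  refine IsHomogeneous.sum _ _ _ fun j _ => IsHomogeneous.C_mul (isHomogeneous_det fun i k => ?_) _
  rw [Matrix.updateCol_apply]
  split_ifs
  · exact isHomogeneous_linPoly _
  · exact isHomogeneous_linPoly _

theorem eval_cramerPoly (φ : BundleMap a b) (F : MvPolynomial (Fin 3) ℂ) (y : Pairs → ℂ) :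
    eval y (H.cramerPoly φ F) = ∑ j, H.coefX j *
      (H.matrixAt φ y).cramer (fun i : Mono N => coeff (i : Fin 3 →₀ ℕ) (y firstPair • F)) j := by
  simp only [cramerPoly, map_sum, map_mul, eval_C, RingHom.map_det, RingHom.mapMatrix_apply,
    Matrix.cramer_apply, Matrix.map_updateCol, map_polyMatrix]
  refine Finset.sum_congr rfl fun j _ => ?_
  congr 3
  ext i
  simp [eval_linPoly, mul_comm]

/-- Otherwise the whole family vanishes at `v`; but it spans the forms of degree `N`, among them the
powers of the variables, so `v` would be zero. -/
theorem firstPair_mul_pow_ne_zero {φ : BundleMap a b} {c : ℂ} {v : Fin 3 → ℂ} (hv : v ≠ 0)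
    (h : eval (c • minorsAt φ v) (H.discr φ) ≠ 0) :
    (c • minorsAt φ v) firstPair * v 0 ^ N ≠ 0 := by
  intro h0
  obtain ⟨i, hi⟩ := Function.ne_iff.1 hv
  rw [eval_discr] at h
  obtain ⟨u, hu⟩ := exists_sum_smul_eq (fun j => H.isHomogeneous_family φ j _) h
    (isHomogeneous_X_pow i N)
  have := congrArg (eval v) hu
  simp only [map_sum, smul_eval, eval_family, h0, zero_mul, mul_zero, Finset.sum_const_zero,
    map_pow, eval_X] at this
  exact pow_ne_zero N hi this.symm

/-- Evaluate Cramer's identity for `y firstPair • F` at `v`: each member of the family contributes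
only its multiple of `y firstPair * v 0 ^ N`, and the common factor `y firstPair` cancels. -/
theorem pow_mul_eval_cramerPoly {φ : BundleMap a b} {c : ℂ} {v : Fin 3 → ℂ} (hv : v ≠ 0)
    (h : eval (c • minorsAt φ v) (H.discr φ) ≠ 0) {F : MvPolynomial (Fin 3) ℂ}
    (hF : F.IsHomogeneous N) :
    v 0 ^ N * eval (c • minorsAt φ v) (H.cramerPoly φ F) =
      eval (c • minorsAt φ v) (H.discr φ) * eval v F := by
  have hne := H.firstPair_mul_pow_ne_zero hv h
  set y := c • minorsAt φ v with hy
  have hF' : (y firstPair • F).IsHomogeneous N := by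
    rw [smul_eq_C_mul]
    exact hF.C_mul _
  have key := congrArg (eval v) (sum_cramer_smul (fun j => H.isHomogeneous_family φ j y) hF')
  rw [← matrixAt, ← eval_discr] at key
  simp only [map_sum, smul_eval, hy, eval_family] at key
  rw [← hy] at key
  refine mul_left_cancel₀ (left_ne_zero_of_mul hne) ?_
  rw [eval_cramerPoly, Finset.mul_sum, Finset.mul_sum]
  rw [mul_left_comm (y firstPair), ← key]
  exact Finset.sum_congr rfl fun j _ => by ring

end Combination

end Inverse

theorem eval_aeval {σ τ : Type*} (v : σ → ℂ) (m : τ → MvPolynomial σ ℂ) (F : MvPolynomial τ ℂ) :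
    eval v (aeval m F) = eval (fun p => eval v (m p)) F := by
  induction F using MvPolynomial.induction_on with
  | C c => simp
  | add p q hp hq => rw [map_add, map_add, map_add, hp, hq]
  | mul_X p l hp => rw [map_mul, map_mul, map_mul, hp, aeval_X, eval_X]

/-! ### The inverse map and birationality -/

section Birational

variable {a b N : ℕ}

namespace Combination

variable (H : Combination a b N)

/-- The homogeneous coordinates of the inverse map. -/
def inversePoly (φ : BundleMap a b) (i : Fin 3) : MvPolynomial Pairs ℂ :=
  H.cramerPoly φ (X 0 ^ (N - 1) * X i)

open Classical in
/-- The inverse map. -/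
def inverseMap (φ : BundleMap a b) (K : Gr24) : P2 :=
  -- The default value is harmless: on the image of the locus `discr` ≠ 0 the coordinates are not
  -- all zero.
  if h : (fun i => eval (coords K) (H.inversePoly φ i)) ≠ 0 then
    Projectivization.mk ℂ _ h else Classical.arbitrary P2

/-- The forms `X 0 ^ (N - 1) * X i` take the values `v 0 ^ (N - 1) * v i`, which are proportional to
`v` because `v 0` is nonzero. -/
theorem exists_eval_inversePoly (hN : 0 < N) {φ : BundleMap a b} {c : ℂ} {v : Fin 3 → ℂ}
    (hv : v ≠ 0) (h : eval (c • minorsAt φ v) (H.discr φ) ≠ 0) :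
    ∃ t : ℂ, t ≠ 0 ∧ (fun i => eval (c • minorsAt φ v) (H.inversePoly φ i)) = t • v := by
  have hv0 : v 0 ≠ 0 := fun h0 =>
    H.firstPair_mul_pow_ne_zero hv h (by simp [h0, hN.ne'])
  refine ⟨eval (c • minorsAt φ v) (H.discr φ) / v 0, div_ne_zero h hv0, ?_⟩
  ext i
  have hF : (X 0 ^ (N - 1) * X i : MvPolynomial (Fin 3) ℂ).IsHomogeneous N := by
    have := (isHomogeneous_X_pow (R := ℂ) (0 : Fin 3) (N - 1)).mul (isHomogeneous_X ℂ i)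
    rwa [Nat.sub_add_cancel hN] at this
  have key := H.pow_mul_eval_cramerPoly hv h hF
  have hp : v 0 ^ N = v 0 ^ (N - 1) * v 0 := by rw [← pow_succ, Nat.sub_add_cancel hN]
  simp only [map_mul, map_pow, eval_X, hp] at key
  rw [Pi.smul_apply, smul_eq_mul, div_mul_eq_mul_div, eq_div_iff hv0]
  refine mul_left_cancel₀ (pow_ne_zero (N - 1) hv0) ?_
  rw [inversePoly]
  linear_combination key

theorem inverseMap_inducedMap (hN : 0 < N) {φ : BundleMap a b} (hφ : IsSurjection φ) {x : P2}
    (h : eval (coords (inducedMap φ hφ x)) (H.discr φ) ≠ 0) :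
    ∃ hne : (fun i => eval (coords (inducedMap φ hφ x)) (H.inversePoly φ i)) ≠ 0,
      x = Projectivization.mk ℂ _ hne := by
  obtain ⟨c, -, hc⟩ := exists_coords_inducedMap hφ x
  rw [hc] at h
  obtain ⟨t, ht, hG⟩ := H.exists_eval_inversePoly hN x.rep_nonzero h
  have hG' : (fun i => eval (coords (inducedMap φ hφ x)) (H.inversePoly φ i)) = t • x.rep := by
    rw [hc, hG]
  refine ⟨by rw [hG']; exact smul_ne_zero ht x.rep_nonzero, ?_⟩
  conv_lhs => rw [← x.mk_rep]
  exact ((Projectivization.mk_eq_mk_iff ℂ _ _ _ _).2 ⟨Units.mk0 t ht, hG'.symm⟩).symm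

/-- The open set of the plane is the full preimage of the locus `discr` ≠ 0 in the Grassmannian, so
its image is exactly the trace of that locus on the range; the vector `v₀` only serves to make it
nonempty. -/
theorem isBirationalOntoImage (hN : 0 < N) {φ : BundleMap a b} (hφ : IsSurjection φ)
    {v₀ : Fin 3 → ℂ} (hv₀ : v₀ ≠ 0) (h₀ : eval (minorsAt φ v₀) (H.discr φ) ≠ 0) :
    IsBirationalOntoImage (inducedMap φ hφ) := by
  set n := Fintype.card (Mono N)
  have hdiscr : ∀ x, eval (coords (inducedMap φ hφ x)) (H.discr φ) ≠ 0 ↔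
      eval (minorsAt φ x.rep) (H.discr φ) ≠ 0 := by
    intro x
    obtain ⟨c, hc0, hc⟩ := exists_coords_inducedMap hφ x
    rw [hc, eval_smul_of_isHomogeneous (H.isHomogeneous_discr φ)]
    simp [hc0]
  refine ⟨isRegularOn_inducedMap hφ,
    {x | eval (coords (inducedMap φ hφ x)) (H.discr φ) ≠ 0},
    {K | eval (coords K) (H.discr φ) ≠ 0}, H.inverseMap φ, ?_, ?_, ?_, ?_, ?_, ?_⟩
  · refine ⟨{aeval (minors φ) (H.discr φ)}, ?_, ?_⟩
    · rintro F rfl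
      exact ⟨_, (H.isHomogeneous_discr φ).aeval _ (isHomogeneous_minors φ)⟩
    · ext x
      have h1 : eval (coords x) (aeval (minors φ) (H.discr φ)) =
          eval (minorsAt φ x.rep) (H.discr φ) :=
        eval_aeval x.rep (minors φ) (H.discr φ)
      constructor
      · rintro hx F rfl
        rw [h1]
        exact not_not.1 fun h => hx ((hdiscr x).2 h)
      · intro hx h
        exact (hdiscr x).1 h (h1.symm.trans (hx _ rfl))
  · refine ⟨Projectivization.mk ℂ v₀ hv₀, (hdiscr _).2 ?_⟩
    obtain ⟨t, ht⟩ := Projectivization.exists_smul_eq_mk_rep ℂ v₀ hv₀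
    have h1 : minorsAt φ (Projectivization.mk ℂ v₀ hv₀).rep = (t : ℂ) ^ (a + b) • minorsAt φ v₀ := by
      rw [← ht]
      ext p
      exact eval_smul_of_isHomogeneous (isHomogeneous_minors φ p) _ _
    rw [h1, eval_smul_of_isHomogeneous (H.isHomogeneous_discr φ)]
    exact mul_ne_zero (pow_ne_zero _ (pow_ne_zero _ t.ne_zero)) h₀
  · exact ⟨{H.discr φ}, fun F hF => ⟨n, by rw [hF]; exact H.isHomogeneous_discr φ⟩, by ext; simp⟩
  · ext K
    constructor
    · rintro ⟨x, hx, rfl⟩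
      exact ⟨hx, x, rfl⟩
    · rintro ⟨hx, x, rfl⟩
      exact ⟨x, hx, rfl⟩
  · intro x hx
    obtain ⟨hne, h⟩ := H.inverseMap_inducedMap hN hφ hx
    rw [inverseMap, dif_pos hne, ← h]
  · intro K _
    refine ⟨Set.univ, ⟨{1}, by simpa using ⟨0, isHomogeneous_one _ _⟩, by simp⟩, trivial, n,
      H.inversePoly φ, fun i => H.isHomogeneous_cramerPoly φ _, ?_⟩
    rintro _ ⟨⟨x, hx, rfl⟩, -⟩
    obtain ⟨hne, h⟩ := H.inverseMap_inducedMap hN hφ hx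
    exact ⟨hne, by rw [inverseMap, dif_pos hne]; rfl⟩

theorem eval_discr_mem_polyFun (v : Fin 3 → ℂ) :
    (fun φ : BundleMap a b => eval (minorsAt φ v) (H.discr φ)) ∈ polyFun (BundleMap a b) := by
  simp only [eval_discr]
  refine det_mem_polyFun fun i j => ?_
  have hA : ∀ (h : MvPolynomial (Fin 3) ℂ) (p : Pairs) (k : Fin 4),
      (fun φ : BundleMap a b => minorsAt φ v p * coeff (i : Fin 3 →₀ ℕ) (h * rowA φ k)) ∈
        polyFun (BundleMap a b) := fun h p k =>
    mul_mem (minorsAt_mem_polyFun v p) (coeff_mul_rowA_mem_polyFun _ _ _)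
  have hB : ∀ (h : MvPolynomial (Fin 3) ℂ) (p : Pairs) (k : Fin 4),
      (fun φ : BundleMap a b => minorsAt φ v p * coeff (i : Fin 3 →₀ ℕ) (h * rowB φ k)) ∈
        polyFun (BundleMap a b) := fun h p k =>
    mul_mem (minorsAt_mem_polyFun v p) (coeff_mul_rowB_mem_polyFun _ _ _)
  have hX : (fun φ : BundleMap a b => minorsAt φ v firstPair *
      coeff (i : Fin 3 →₀ ℕ) (C (H.coefX j) * X 0 ^ N)) ∈ polyFun (BundleMap a b) :=
    mul_mem (minorsAt_mem_polyFun v _) (const_mem_polyFun _)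
  have := add_mem (sum_mem fun (k : {k : Fin 4 // 1 < k}) (_ : k ∈ Finset.univ) =>
    add_mem (add_mem (sub_mem (hA (H.coefA j k) ⟨(1, k.1), k.2⟩ 0)
      (hA (H.coefA j k) ⟨(0, k.1), lt_trans (show (0 : Fin 4) < 1 by decide) k.2⟩ 1))
      (hA (H.coefA j k) firstPair k))
    (add_mem (sub_mem (hB (H.coefB j k) ⟨(1, k.1), k.2⟩ 0)
      (hB (H.coefB j k) ⟨(0, k.1), lt_trans (show (0 : Fin 4) < 1 by decide) k.2⟩ 1))
      (hB (H.coefB j k) firstPair k))) hX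
  convert this using 1
  ext φ
  simp only [matrixAt, coeffMatrix, Matrix.of_apply, family_apply, coeff_add, coeff_sum, incidence,
    LinearMap.add_apply, LinearMap.sub_apply, LinearMap.smulRight_apply, LinearMap.proj_apply,
    mul_add, mul_sub, mul_smul_comm, coeff_sub, coeff_smul, smul_eq_mul, Pi.add_apply,
    Finset.sum_apply, Pi.sub_apply]

theorem eval_discr_of_family_eq {φ : BundleMap a b} {y : Pairs → ℂ}
    (h : ∀ j, H.family φ j y = monomial (j : Fin 3 →₀ ℕ) 1) : eval y (H.discr φ) = 1 := by
  rw [eval_discr, matrixAt, funext h, coeffMatrix_monomial, Matrix.det_one]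

end Combination

end Birational

/-! ### A special bundle map -/

section Special

variable (a b : ℕ)

/-- The first row `(x ^ a + y ^ a, 0, x ^ (a - 1) * y, z ^ a)`. -/
def specialRowA : Fin 4 → MvPolynomial (Fin 3) ℂ :=
  ![X 0 ^ a + X 1 ^ a, 0, X 0 ^ (a - 1) * X 1, X 2 ^ a]

/-- The second row `(0, x ^ b + z ^ b, 2 * y ^ b, x ^ (b - 1) * z)`. -/
def specialRowB : Fin 4 → MvPolynomial (Fin 3) ℂ :=
  ![0, X 0 ^ b + X 2 ^ b, C 2 * X 1 ^ b, X 0 ^ (b - 1) * X 2]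

variable {a b}

theorem isHomogeneous_specialRowA (ha : 0 < a) (i : Fin 4) : (specialRowA a i).IsHomogeneous a := by
  fin_cases i
  · exact (isHomogeneous_X_pow 0 a).add (isHomogeneous_X_pow 1 a)
  · exact isHomogeneous_zero _ _ _
  · have := (isHomogeneous_X_pow (R := ℂ) (0 : Fin 3) (a - 1)).mul (isHomogeneous_X ℂ 1)
    rwa [Nat.sub_add_cancel ha] at this
  · exact isHomogeneous_X_pow 2 a

theorem isHomogeneous_specialRowB (hb : 0 < b) (i : Fin 4) : (specialRowB b i).IsHomogeneous b := by
  fin_cases i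
  · exact isHomogeneous_zero _ _ _
  · exact (isHomogeneous_X_pow 0 b).add (isHomogeneous_X_pow 2 b)
  · exact (isHomogeneous_X_pow 1 b).C_mul 2
  · have := (isHomogeneous_X_pow (R := ℂ) (0 : Fin 3) (b - 1)).mul (isHomogeneous_X ℂ 2)
    rwa [Nat.sub_add_cancel hb] at this

theorem exists_special (ha : 0 < a) (hb : 0 < b) :
    ∃ φ : BundleMap a b, rowA φ = specialRowA a ∧ rowB φ = specialRowB b :=
  ⟨ofRows
    (fun i => ⟨specialRowA a i, (mem_homogeneousSubmodule a _).2 (isHomogeneous_specialRowA ha i)⟩)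
    (fun i => ⟨specialRowB b i, (mem_homogeneousSubmodule b _).2 (isHomogeneous_specialRowB hb i)⟩),
    funext fun _ => rowA_ofRows _ _ _, funext fun _ => rowB_ofRows _ _ _⟩

/-- At (1, 0, 0) the two rows are the first two standard basis vectors of ℂ⁴. -/
theorem minorsAt_special {φ : BundleMap a b} (hA : rowA φ = specialRowA a)
    (hB : rowB φ = specialRowB b) (ha : 0 < a) (hb : 0 < b) :
    minorsAt φ (Pi.single 0 1) = Pi.single firstPair 1 := by
  ext ⟨⟨i, j⟩, hij⟩
  fin_cases i <;> fin_cases j <;>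
    first
      | exact absurd hij (by decide)
      | simp [minorsAt, minors, hA, hB, specialRowA, specialRowB, firstPair, ha.ne', hb.ne']

/-- If exactly one of x^a + y^a and x^b + z^b vanishes, or neither does, the minors involving the
first two columns give a contradiction. If both vanish, x, y, z have equal absolute values and the
last minor decides. -/
theorem eq_zero_of_minors_special {φ : BundleMap a b} (hA : rowA φ = specialRowA a)
    (hB : rowB φ = specialRowB b) (ha : 0 < a) (hb : 0 < b) (v : Fin 3 → ℂ)
    (hv : ∀ p, eval v (minors φ p) = 0) : v = 0 := by
  have h01 := hv ⟨(0, 1), by decide⟩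
  have h02 := hv ⟨(0, 2), by decide⟩
  have h03 := hv ⟨(0, 3), by decide⟩
  have h12 := hv ⟨(1, 2), by decide⟩
  have h13 := hv ⟨(1, 3), by decide⟩
  have h23 := hv ⟨(2, 3), by decide⟩
  simp only [minors, hA, hB, specialRowA, specialRowB] at h01 h02 h03 h12 h13 h23
  simp at h01 h02 h03 h12 h13 h23
  have zero_of : ∀ {n : ℕ} {u : ℂ}, 0 < n → v 0 = 0 → v 0 ^ n + u ^ n = 0 → u = 0 := by
    intro n u hn h0 h
    rw [h0, zero_pow hn.ne', zero_add] at h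
    exact pow_eq_zero_iff hn.ne' |>.1 h
  have zero_of' : ∀ {n : ℕ} {u : ℂ}, 0 < n → u = 0 → v 0 ^ n + u ^ n = 0 → v 0 = 0 := by
    intro n u hn h0 h
    rw [h0, zero_pow hn.ne', add_zero] at h
    exact pow_eq_zero_iff hn.ne' |>.1 h
  have norm_eq : ∀ {n : ℕ} {u : ℂ}, 0 < n → v 0 ^ n + u ^ n = 0 → ‖u‖ = ‖v 0‖ := by
    intro n u hn h
    have := congrArg norm (eq_neg_of_add_eq_zero_right h)
    rw [norm_neg, norm_pow, norm_pow] at this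
    exact (pow_left_inj₀ (norm_nonneg _) (norm_nonneg _) hn.ne').1 this
  have h0 : v 0 = 0 ∧ v 0 ^ a + v 1 ^ a = 0 ∧ v 0 ^ b + v 2 ^ b = 0 := by
    by_cases hP : v 0 ^ a + v 1 ^ a = 0
    · by_cases hQ : v 0 ^ b + v 2 ^ b = 0
      · refine ⟨?_, hP, hQ⟩
        -- The constant 2 in the second row acts here: taking norms gives |x|^(a+b) = 2|x|^(a+b), so
        -- x = 0.
        have hn := congrArg norm (sub_eq_zero.1 h23)
        simp only [norm_mul, norm_pow, norm_eq ha hP, norm_eq hb hQ, Complex.norm_ofNat] at hn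
        have e1 : ‖v 0‖ ^ (a - 1) * ‖v 0‖ = ‖v 0‖ ^ a := by
          rw [← pow_succ, Nat.sub_add_cancel ha]
        have e2 : ‖v 0‖ ^ (b - 1) * ‖v 0‖ = ‖v 0‖ ^ b := by
          rw [← pow_succ, Nat.sub_add_cancel hb]
        rw [e1, e2] at hn
        have h3 : ‖v 0‖ ^ (a + b) = 0 := by
          rw [pow_add]
          linarith
        exact norm_eq_zero.1 (pow_eq_zero_iff (by omega) |>.1 h3)
      · have h2 : v 2 = 0 := (h13.resolve_right hQ).1
        rcases h12.resolve_right hQ with h | h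
        · exact absurd (by rw [h.1, h2, zero_pow hb.ne', add_zero]) hQ
        · exact absurd (by rw [zero_of' ha h hP, h2, zero_pow hb.ne', add_zero]) hQ
    · have h1 : v 1 = 0 := (h02.resolve_left hP).1
      have hQ := h01.resolve_left hP
      rcases h03.resolve_left hP with h | h
      · exact absurd (by rw [h.1, h1, zero_pow ha.ne', add_zero]) hP
      · exact absurd (by rw [zero_of' hb h hQ, h1, zero_pow ha.ne', add_zero]) hP
  ext i
  fin_cases i
  · exact h0.1
  · exact zero_of ha h0.1 h0.2.1
  · exact zero_of hb h0.1 h0.2.2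

/-- The monomials of degree `2 * a + b` other than the power of the first variable lie in the ideal
of the last two columns of the special bundle map. -/
theorem exists_combination_special {φ : BundleMap a b} (hA : rowA φ = specialRowA a)
    (hB : rowB φ = specialRowB b) (ha : 0 < a) (hb : 0 < b) :
    ∃ H : Combination a b (2 * a + b), ∀ j,
      H.family φ j (Pi.single firstPair 1) = monomial (j : Fin 3 →₀ ℕ) 1 := by
  have key : ∀ j : Mono (2 * a + b), ∃ (f g : {k : Fin 4 // 1 < k} → MvPolynomial (Fin 3) ℂ) (c : ℂ),
      (∀ k, (f k).IsHomogeneous (a + b)) ∧ (∀ k, (g k).IsHomogeneous (2 * a)) ∧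
      ∑ k, (f k * rowA φ k + g k * rowB φ k) + C c * X 0 ^ (2 * a + b) =
        monomial (j : Fin 3 →₀ ℕ) 1 := by
    rintro ⟨j, hj⟩
    rw [mem_mono] at hj
    have hmon : monomial j (1 : ℂ) = X 0 ^ j 0 * X 1 ^ j 1 * X 2 ^ j 2 := by
      rw [monomial_eq, Finsupp.prod_fintype _ _ (by simp), Fin.prod_univ_three, C_1, one_mul]
    have hom : ∀ {p q r n : ℕ}, p + q + r = n →
        (X 0 ^ p * X 1 ^ q * X 2 ^ r : MvPolynomial (Fin 3) ℂ).IsHomogeneous n := by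
      rintro p q r _ rfl
      exact ((isHomogeneous_X_pow 0 p).mul (isHomogeneous_X_pow 1 q)).mul (isHomogeneous_X_pow 2 r)
    have hsingle : ∀ {n : ℕ} (k : {k : Fin 4 // 1 < k}) {m : MvPolynomial (Fin 3) ℂ},
        m.IsHomogeneous n → ∀ l, (Pi.single k m : _ → MvPolynomial (Fin 3) ℂ) l |>.IsHomogeneous n := by
      intro n k m hm l
      rw [Pi.single_apply]
      split_ifs
      · exact hm
      · exact isHomogeneous_zero _ _ _
    have hzero : ∀ (n : ℕ) (l : {k : Fin 4 // 1 < k}),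
        ((0 : {k : Fin 4 // 1 < k} → MvPolynomial (Fin 3) ℂ) l).IsHomogeneous n := fun n _ => isHomogeneous_zero _ _ _
    have useA : ∀ (k : {k : Fin 4 // 1 < k}) (m : MvPolynomial (Fin 3) ℂ),
        m.IsHomogeneous (a + b) → m * rowA φ k = monomial j 1 →
        ∃ (f g : {k : Fin 4 // 1 < k} → MvPolynomial (Fin 3) ℂ) (c : ℂ),
          (∀ k, (f k).IsHomogeneous (a + b)) ∧ (∀ k, (g k).IsHomogeneous (2 * a)) ∧
          ∑ k, (f k * rowA φ k + g k * rowB φ k) + C c * X 0 ^ (2 * a + b) = monomial j 1 := by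
      intro k m hm h
      refine ⟨Pi.single k m, 0, 0, hsingle k hm, hzero _, ?_⟩
      simp [Pi.single_apply, h]
    have useB : ∀ (k : {k : Fin 4 // 1 < k}) (m : MvPolynomial (Fin 3) ℂ),
        m.IsHomogeneous (2 * a) → m * rowB φ k = monomial j 1 →
        ∃ (f g : {k : Fin 4 // 1 < k} → MvPolynomial (Fin 3) ℂ) (c : ℂ),
          (∀ k, (f k).IsHomogeneous (a + b)) ∧ (∀ k, (g k).IsHomogeneous (2 * a)) ∧
          ∑ k, (f k * rowA φ k + g k * rowB φ k) + C c * X 0 ^ (2 * a + b) = monomial j 1 := by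
      intro k m hm h
      refine ⟨0, Pi.single k m, 0, hzero _, hsingle k hm, ?_⟩
      simp [Pi.single_apply, h]
    -- Degree 2a + b suffices: if `j 2 < a` and `j 1 < b`, then `j 0` exceeds a, so the first case
    -- applies unless `j 1 = 0`; then `j 0` exceeds b and the fourth applies unless `j 2 = 0`.
    have cases : (1 ≤ j 1 ∧ a - 1 ≤ j 0) ∨ a ≤ j 2 ∨ b ≤ j 1 ∨ (1 ≤ j 2 ∧ b - 1 ≤ j 0) ∨
        (j 0 = 2 * a + b ∧ j 1 = 0 ∧ j 2 = 0) := by omega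
    rcases cases with ⟨h1, h0⟩ | h2 | h1 | ⟨h2, h0⟩ | ⟨h0, h1, h2⟩
    · obtain ⟨p, hp⟩ := Nat.exists_eq_add_of_le h0
      obtain ⟨q, hq⟩ := Nat.exists_eq_add_of_le h1
      refine useA ⟨2, by decide⟩ (X 0 ^ p * X 1 ^ q * X 2 ^ j 2) (hom (by omega)) ?_
      rw [hmon, hA, hp, hq]
      simp only [specialRowA, Matrix.cons_val]
      ring
    · obtain ⟨r, hr⟩ := Nat.exists_eq_add_of_le h2
      refine useA ⟨3, by decide⟩ (X 0 ^ j 0 * X 1 ^ j 1 * X 2 ^ r) (hom (by omega)) ?_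
      rw [hmon, hA, hr]
      simp only [specialRowA, Matrix.cons_val]
      ring
    · obtain ⟨q, hq⟩ := Nat.exists_eq_add_of_le h1
      refine useB ⟨2, by decide⟩ (C 2⁻¹ * (X 0 ^ j 0 * X 1 ^ q * X 2 ^ j 2))
        ((hom (by omega)).C_mul _) ?_
      have h2 : (C 2⁻¹ * C 2 : MvPolynomial (Fin 3) ℂ) = 1 := by rw [← C_mul]; simp
      rw [hmon, hB, hq]
      simp only [specialRowB, Matrix.cons_val]
      linear_combination (X 0 ^ j 0 * X 1 ^ (b + q) * X 2 ^ j 2) * h2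
    · obtain ⟨p, hp⟩ := Nat.exists_eq_add_of_le h0
      obtain ⟨r, hr⟩ := Nat.exists_eq_add_of_le h2
      refine useB ⟨3, by decide⟩ (X 0 ^ p * X 1 ^ j 1 * X 2 ^ r) (hom (by omega)) ?_
      rw [hmon, hB, hp, hr]
      simp only [specialRowB, Matrix.cons_val]
      ring
    · refine ⟨0, 0, 1, hzero _, hzero _, ?_⟩
      rw [hmon, h0, h1, h2]
      simp
  choose f g c hf hg h using key
  refine ⟨⟨a + b, 2 * a, f, g, c, by omega, by omega, hf, hg⟩, fun j => ?_⟩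
  simp only [Combination.family_apply, incidence_single, Pi.single_eq_same, one_smul]
  exact h j

end Special

end PlaneGr

end

/-! ### The generic open set -/

open PlaneGr
theorem mainTheorem6 (a b : ℕ) (ha : 0 < a) (hb : 0 < b) (hab : Nat.Coprime a b) :
    ∃ U : Set (BundleMap a b), IsZariskiOpenLinear U ∧ U.Nonempty ∧
      ∀ φ ∈ U, ∃ hφ : IsSurjection φ, IsBirationalOntoImage (inducedMap φ hφ) := by
  obtain ⟨φ₀, hA, hB⟩ := exists_special ha hb
  obtain ⟨D, hD, hD₀, hsurj⟩ :=
    exists_polyFun_isSurjection (eq_zero_of_minors_special hA hB ha hb)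
  obtain ⟨H, hH⟩ := exists_combination_special hA hB ha hb
  have hv₀ : (Pi.single 0 1 : Fin 3 → ℂ) ≠ 0 := by simp
  -- The open set is the nonvanishing locus of the product of the surjectivity determinant and
  -- `discr` at (1, 0, 0); `φ₀` lies in it.
  refine ⟨_, isZariskiOpenLinear_ne_zero (mul_mem hD (H.eval_discr_mem_polyFun (Pi.single 0 1))),
    ⟨φ₀, mul_ne_zero hD₀ ?_⟩, fun φ hφ => ?_⟩
  · simp only [minorsAt_special hA hB ha hb, H.eval_discr_of_family_eq hH]
    exact one_ne_zero
  · have hφ' := hsurj φ (left_ne_zero_of_mul hφ)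
    exact ⟨hφ', H.isBirationalOntoImage (by omega) hφ' hv₀ (right_ne_zero_of_mul hφ)⟩
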